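/- Let $\mathfrak H$ be a real separable Hilbert space and let $X=\{X(h):h\in\mathfrak H\}$ be an isonormal Gaussian process over $\mathfrak H$ on a probability space $(\Omega,\mathcal F,P)$, that is, a centered jointly Gaussian family with $E[X(g)X(h)]=\langle g,h\rangle_{\mathfrak H}$ for all $g,h\in\mathfrak H$. For $q\ge 1$ let the $q$th Wiener chaos $\mathcal H_q$ of $X$ be the closed linear subspace of $L^2(\Omega,\mathcal F,P)$ generated by the random variables $H_q(X(h))$ with $h\in\mathfrak H$, $\|h\|_{\mathfrak H}=1$, where $H_q(x)=(-1)^q e^{x^2/2}\frac{d^q}{dx^q}e^{-x^2/2}$ is the $q$th Hermite polynomial. Let $q\ge 2$ be an integer, let $Z\in\mathcal H_q$ have variance $\mathrm{Var}(Z)=1$, and let $N\sim\mathcal N(0,1)$. Then $E(Z^4)<\infty$, $E(Z^4)\ge E(N^4)$, and for every integer $k\ge 3$ one has $E|Z|^k<\infty$ and $$\big|E(Z^k)-E(N^k)\big|\le c_{k,q}\sqrt{E(Z^4)-E(N^4)},$$ where $$c_{k,q}=(k-1)\,2^{k-\frac52}\sqrt{\frac{q-1}{3q}}\left(\sqrt{\frac{(2k-4)!}{2^{k-2}(k-2)!}}+(2k-5)^{\frac{kq}{2}-q}\right).$$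 -/

import Mathlib

open MeasureTheory ProbabilityTheory

/-- `X = (X h)_{h ∈ H}` is an isonormal Gaussian process over the real Hilbert space `H`, defined
on `(Ω, P)`: a centred (jointly) Gaussian family with `E[X(g) X(h)] = ⟪g, h⟫`. -/
structure IsIsonormal {H Ω : Type*} [NormedAddCommGroup H] [InnerProductSpace ℝ H]
    {mΩ : MeasurableSpace Ω} (X : H → Ω → ℝ) (P : Measure Ω) : Prop where
  isGaussianProcess : IsGaussianProcess X P
  integral_eq_zero : ∀ h : H, ∫ ω, X h ω ∂P = 0
  integral_mul_eq_inner : ∀ g h : H, ∫ ω, X g ω * X h ω ∂P = inner ℝ g h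

/-- The `q`-th Wiener chaos of `X`: the closed linear subspace of `L²(Ω, P)` generated by the
(classes of the) random variables `H_q(X(h))` with `‖h‖ = 1`. Here `Polynomial.hermite q` is the
probabilists' Hermite polynomial `(-1)^q e^{x²/2} (d/dx)^q e^{-x²/2}`. For `q = 0` it is the space
of constants: `H_0 = 1`, and the restriction on `h` is dropped only so that this also holds when
`H = 0`. -/
noncomputable def wienerChaos {H Ω : Type*} [NormedAddCommGroup H] [InnerProductSpace ℝ H]
    {mΩ : MeasurableSpace Ω} (X : H → Ω → ℝ) (P : Measure Ω) (q : ℕ) :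
    Submodule ℝ (Lp ℝ 2 P) :=
  (Submodule.span ℝ {F : Lp ℝ 2 P | ∃ h : H, (‖h‖ = 1 ∨ q = 0) ∧
    F =ᵐ[P] fun ω => Polynomial.aeval (X h ω) (Polynomial.hermite q)}).topologicalClosure

/-- The constant `c_{k,q}`; it is used for `k ≥ 3` and `q ≥ 2`. -/
noncomputable def momentConst (k q : ℕ) : ℝ :=
  ((k : ℝ) - 1) * (2 : ℝ) ^ ((k : ℝ) - 5 / 2) * √(((q : ℝ) - 1) / (3 * (q : ℝ))) *
    (√((Nat.factorial (2 * k - 4) : ℝ) / ((2 : ℝ) ^ (k - 2) * (Nat.factorial (k - 2) : ℝ)))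
      + (2 * (k : ℝ) - 5) ^ ((k : ℝ) * (q : ℝ) / 2 - (q : ℝ)))

/-! Finite combinations of the variables `H_q(X(h))` are dense in the chaos, and each has the
moments of a polynomial `f` in finitely many independent standard Gaussians. On such `f`, Gaussian
integration by parts is the only analytic input. Write `L` for the Ornstein–Uhlenbeck operator and
`Γ` for `carreDuChamp f f`, and assume `E f² = 1`.

Since `L f = -q f`, integration by parts gives `q E f^(k+2) = (k+1) E(f^k Γ)`, hence `E f^(k+2) -
(k+1) E f^k = ((k+1)/q) E(f^k (Γ - q))`. The Gaussian moments satisfy the same recursion with zero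
right-hand side. By Cauchy–Schwarz the error is controlled by two quantities.

The first is `E f^(2k) ≤ (2k-1)^(qk)`, hypercontractivity, proved by induction on `q` through
gradients (`map_pow_sum_sq_le`). The second is `E (Γ - q)² ≤ (q(q-1)/3) (E f⁴ - 3)`
(`map_carreDuChamp_sq_sub_le`): split `f² = ∑ g_j` with `L g_j = -2j g_j`, so that `Γ = ∑ (q-j)
g_j`, and compare `E Γ²` with `E(f² Γ) = q E f⁴ / 3` term by term. Nonnegativity of the left side
also gives `E f⁴ ≥ 3` when `q ≥ 2`.

Solving the recursion for the moment defects (`abs_sub_le_of_moment_recursion`) gives the bound for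
`f`. Hypercontractivity bounds all even moments along an `L²` approximation of `Z`, so every moment
converges and the inequality passes to the limit. -/

namespace GaussianPolynomial

open MvPolynomial

variable {σ : Type}

/-! ### Ornstein–Uhlenbeck operator and carré du champ -/

section Operators

variable [Fintype σ]

/-- The Ornstein–Uhlenbeck operator `∑ i, ∂ᵢ² - Xᵢ ∂ᵢ` on polynomials. -/
noncomputable def ornsteinUhlenbeck : MvPolynomial σ ℝ →ₗ[ℝ] MvPolynomial σ ℝ :=
  ∑ i, ((pderiv i).toLinearMap ∘ₗ (pderiv i).toLinearMap
    - LinearMap.mulLeft ℝ (X i) ∘ₗ (pderiv i).toLinearMap)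

/-- The carré du champ `∑ i, ∂ᵢ p ∂ᵢ r`. -/
noncomputable def carreDuChamp (p r : MvPolynomial σ ℝ) : MvPolynomial σ ℝ :=
  ∑ i, pderiv i p * pderiv i r

lemma ornsteinUhlenbeck_apply (p : MvPolynomial σ ℝ) :
    ornsteinUhlenbeck p = ∑ i, (pderiv i (pderiv i p) - X i * pderiv i p) := by
  simp [ornsteinUhlenbeck]

/-- The carré du champ is half the defect in the Leibniz rule; this is how `Γ(f, f)` is later read
off from the eigenvector expansion of `f²`. -/
lemma ornsteinUhlenbeck_mul (p r : MvPolynomial σ ℝ) :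
    ornsteinUhlenbeck (p * r) = p * ornsteinUhlenbeck r + r * ornsteinUhlenbeck p
      + 2 * carreDuChamp p r := by
  simp only [ornsteinUhlenbeck_apply, carreDuChamp, Finset.mul_sum, ← Finset.sum_add_distrib]
  refine Finset.sum_congr rfl fun i _ => ?_
  simp only [pderiv_mul, map_add]
  ring

lemma carreDuChamp_mul_left (p r s : MvPolynomial σ ℝ) :
    carreDuChamp (p * r) s = p * carreDuChamp r s + r * carreDuChamp p s := by
  simp only [carreDuChamp, Finset.mul_sum, ← Finset.sum_add_distrib, pderiv_mul]
  exact Finset.sum_congr rfl fun i _ => by ring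

lemma carreDuChamp_pow_left (f : MvPolynomial σ ℝ) (n : ℕ) :
    carreDuChamp (f ^ (n + 1)) f = (n + 1 : ℕ) * (f ^ n * carreDuChamp f f) := by
  simp only [carreDuChamp, Finset.mul_sum, pderiv_pow]
  exact Finset.sum_congr rfl fun i _ => by simp only [Nat.add_sub_cancel]; ring

end Operators

/-- A positive normalized linear functional on polynomials satisfying the Gaussian integration by
parts formula; the expectation of a polynomial in independent standard Gaussians is the model. -/
structure IsGaussianExpectation (E : MvPolynomial σ ℝ →ₗ[ℝ] ℝ) : Prop where
  map_one : E 1 = 1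
  map_X_mul : ∀ i p, E (X i * p) = E (pderiv i p)
  nonneg : ∀ p, (∀ x, 0 ≤ eval x p) → 0 ≤ E p

/-! ### Cauchy–Schwarz, integration by parts and orthogonality -/

namespace IsGaussianExpectation

variable {E : MvPolynomial σ ℝ →ₗ[ℝ] ℝ}

lemma map_C (hE : IsGaussianExpectation E) (c : ℝ) : E (C c) = c := by
  rw [← mul_one (C c), ← smul_eq_C_mul, map_smul, hE.map_one, smul_eq_mul, mul_one]

lemma mono (hE : IsGaussianExpectation E) {p r : MvPolynomial σ ℝ}
    (h : ∀ x, eval x p ≤ eval x r) : E p ≤ E r := by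
  have := hE.nonneg (r - p) fun x => by simpa using h x
  rw [map_sub] at this
  linarith

/-- The quadratic `t ↦ E((p + t r)²)` is nonnegative, so its discriminant is nonpositive. -/
lemma sq_map_mul_le (hE : IsGaussianExpectation E) (p r : MvPolynomial σ ℝ) :
    E (p * r) ^ 2 ≤ E (p ^ 2) * E (r ^ 2) := by
  have key : ∀ t : ℝ, 0 ≤ E (r ^ 2) * (t * t) + (2 * E (p * r)) * t + E (p ^ 2) := by
    intro t
    have h := hE.nonneg ((p + t • r) ^ 2) fun x => by
      rw [map_pow]; positivity
    have e : (p + t • r) ^ 2 = p ^ 2 + (2 * t) • (p * r) + (t * t) • r ^ 2 := by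
      simp only [smul_eq_C_mul, map_mul]
      rw [show (C (2 : ℝ) : MvPolynomial σ ℝ) = 2 from map_ofNat C 2]
      ring
    rw [e, map_add, map_add, map_smul, map_smul, smul_eq_mul, smul_eq_mul] at h
    linarith
  have := discrim_le_zero key
  rw [discrim] at this
  nlinarith

variable [Fintype σ]

lemma map_carreDuChamp (hE : IsGaussianExpectation E) (p r : MvPolynomial σ ℝ) :
    E (carreDuChamp p r) = -E (p * ornsteinUhlenbeck r) := by
  simp only [carreDuChamp, ornsteinUhlenbeck_apply, Finset.mul_sum, map_sum,
    ← Finset.sum_neg_distrib]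
  refine Finset.sum_congr rfl fun i _ => ?_
  have h := hE.map_X_mul i (p * pderiv i r)
  rw [pderiv_mul, map_add, show X i * (p * pderiv i r) = p * (X i * pderiv i r) by ring] at h
  rw [mul_sub, map_sub]
  linarith

lemma map_carreDuChamp_of_eigen (hE : IsGaussianExpectation E) (p : MvPolynomial σ ℝ)
    {f : MvPolynomial σ ℝ} {q : ℝ} (hf : ornsteinUhlenbeck f = -(q • f)) :
    E (carreDuChamp p f) = q * E (p * f) := by
  rw [hE.map_carreDuChamp, hf, mul_neg, map_neg, neg_neg, mul_smul_comm, map_smul, smul_eq_mul]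

lemma carreDuChamp_comm (p r : MvPolynomial σ ℝ) : carreDuChamp p r = carreDuChamp r p := by
  simp only [carreDuChamp, mul_comm]

/-- Eigenvectors for distinct eigenvalues are orthogonal. -/
lemma map_mul_eq_zero (hE : IsGaussianExpectation E) {f g : MvPolynomial σ ℝ} {a b : ℝ}
    (hf : ornsteinUhlenbeck f = -(a • f)) (hg : ornsteinUhlenbeck g = -(b • g)) (hab : a ≠ b) :
    E (f * g) = 0 := by
  have h1 := hE.map_carreDuChamp_of_eigen f hg
  have h2 := hE.map_carreDuChamp_of_eigen g hf
  rw [carreDuChamp_comm, mul_comm g f] at h2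
  have : (a - b) * E (f * g) = 0 := by linarith
  exact (mul_eq_zero.1 this).resolve_left (sub_ne_zero.2 hab)

end IsGaussianExpectation

/-! ### Hermite polynomials of linear forms and the polynomial chaos -/

section Hermite

variable [Fintype σ]

open Polynomial in
lemma derivative_hermite_succ (n : ℕ) :
    derivative (hermite (n + 1)) = ((n : ℤ[X]) + 1) * hermite n := by
  induction n with
  | zero => simp
  | succ n ih =>
    rw [hermite_succ (n + 1), derivative_sub, derivative_mul, derivative_X, ih]
    have : derivative (((n : ℤ[X]) + 1) * hermite n) = ((n : ℤ[X]) + 1) * derivative (hermite n) := by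
      rw [derivative_mul]; simp
    rw [this, hermite_succ n]
    push_cast
    ring

/-- The linear form with coefficients `c`. -/
noncomputable def linearForm (c : σ → ℝ) : MvPolynomial σ ℝ := ∑ i, C (c i) * X i

lemma pderiv_linearForm (c : σ → ℝ) (i : σ) : pderiv i (linearForm c) = C (c i) := by
  classical
  simp [linearForm, pderiv_X, Pi.single_apply]

lemma eval_linearForm (c x : σ → ℝ) : eval x (linearForm c) = ∑ i, c i * x i := by
  simp [linearForm]

/-- The `q`-th Hermite polynomial of a linear form. -/
noncomputable def hermiteForm (q : ℕ) (c : σ → ℝ) : MvPolynomial σ ℝ :=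
  Polynomial.aeval (linearForm c) (Polynomial.hermite q)

lemma pderiv_aeval_linearForm (P : Polynomial ℤ) (c : σ → ℝ) (i : σ) :
    pderiv i (Polynomial.aeval (linearForm c) P)
      = C (c i) * Polynomial.aeval (linearForm c) (Polynomial.derivative P) := by
  have h := ((pderiv i : Derivation ℝ (MvPolynomial σ ℝ) _).restrictScalars ℤ).map_aeval P
    (linearForm c)
  rw [smul_eq_mul, Derivation.restrictScalars_apply, Derivation.restrictScalars_apply,
    pderiv_linearForm, mul_comm] at h
  exact h

lemma pderiv_hermiteForm (q : ℕ) (c : σ → ℝ) (i : σ) :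
    pderiv i (hermiteForm (q + 1) c) = ((q + 1 : ℝ) * c i) • hermiteForm q c := by
  rw [hermiteForm, pderiv_aeval_linearForm, derivative_hermite_succ, smul_eq_C_mul, hermiteForm]
  simp
  ring

lemma hermiteForm_zero (c : σ → ℝ) : hermiteForm 0 c = 1 := by simp [hermiteForm]

lemma hermiteForm_succ_succ (q : ℕ) (c : σ → ℝ) :
    hermiteForm (q + 2) c = linearForm c * hermiteForm (q + 1) c
      - (q + 1 : ℝ) • hermiteForm q c := by
  rw [hermiteForm, Polynomial.hermite_succ, derivative_hermite_succ, smul_eq_C_mul]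
  simp [hermiteForm]

/-- Because `c` has norm one, the Laplacian of `H_q(c · x)` is `H_q''(c · x)`, and the claim is
Hermite's equation, here a form of the three-term recurrence. -/
lemma ornsteinUhlenbeck_hermiteForm (q : ℕ) {c : σ → ℝ} (hc : ∑ i, c i ^ 2 = 1) :
    ornsteinUhlenbeck (hermiteForm q c) = -((q : ℝ) • hermiteForm q c) := by
  rw [ornsteinUhlenbeck_apply]
  match q with
  | 0 => simp [hermiteForm_zero]
  | 1 =>
    simp only [pderiv_hermiteForm, hermiteForm_zero]
    simp [hermiteForm, linearForm, smul_eq_C_mul, mul_comm]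
  | q + 2 =>
    have h : ∀ i, pderiv i (pderiv i (hermiteForm (q + 2) c)) - X i * pderiv i (hermiteForm (q + 2) c)
      = (q + 2 : ℝ) • ((c i ^ 2) • ((q + 1 : ℝ) • hermiteForm q c)
          - (C (c i) * X i) * hermiteForm (q + 1) c) := by
      intro i
      rw [pderiv_hermiteForm, Derivation.map_smul, pderiv_hermiteForm]
      simp only [smul_eq_C_mul, map_mul, map_add, map_pow]
      push_cast
      simp only [map_add, map_natCast, map_one, map_ofNat]
      ring
    simp only [h]
    rw [← Finset.smul_sum, Finset.sum_sub_distrib, ← Finset.sum_smul, ← Finset.sum_mul, hc,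
      one_smul, hermiteForm_succ_succ, linearForm]
    push_cast
    rw [← smul_neg, neg_sub]

/-- The span of the polynomials `H_q(c · X)` with `c` of Euclidean norm one. -/
noncomputable def chaos (σ : Type) [Fintype σ] (q : ℕ) : Submodule ℝ (MvPolynomial σ ℝ) :=
  Submodule.span ℝ {p | ∃ c : σ → ℝ, ∑ i, c i ^ 2 = 1 ∧ p = hermiteForm q c}

lemma ornsteinUhlenbeck_of_mem_chaos {q : ℕ} {p : MvPolynomial σ ℝ} (hp : p ∈ chaos σ q) :
    ornsteinUhlenbeck p = -((q : ℝ) • p) := by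
  induction hp using Submodule.span_induction with
  | mem p hp =>
    obtain ⟨c, hc, rfl⟩ := hp
    exact ornsteinUhlenbeck_hermiteForm q hc
  | zero => simp
  | add p r _ _ hp hr => rw [map_add, hp, hr, smul_add, neg_add]
  | smul a p _ hp => rw [map_smul, hp, smul_neg, smul_comm]

lemma pderiv_mem_chaos {q : ℕ} {p : MvPolynomial σ ℝ} (hp : p ∈ chaos σ (q + 1)) (i : σ) :
    pderiv i p ∈ chaos σ q := by
  induction hp using Submodule.span_induction with
  | mem p hp =>
    obtain ⟨c, hc, rfl⟩ := hp
    rw [pderiv_hermiteForm]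
    exact Submodule.smul_mem _ _ (Submodule.subset_span ⟨c, hc, rfl⟩)
  | zero => simp
  | add p r _ _ hp hr => rw [map_add]; exact add_mem hp hr
  | smul a p _ hp => rw [Derivation.map_smul]; exact Submodule.smul_mem _ _ hp

lemma exists_eq_C_of_mem_chaos_zero {p : MvPolynomial σ ℝ} (hp : p ∈ chaos σ 0) :
    ∃ a, p = C a := by
  induction hp using Submodule.span_induction with
  | mem p hp =>
    obtain ⟨c, hc, rfl⟩ := hp
    exact ⟨1, by simp [hermiteForm_zero]⟩
  | zero => exact ⟨0, by simp⟩
  | add p r _ _ hp hr =>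
    obtain ⟨⟨a, rfl⟩, b, rfl⟩ := hp, hr
    exact ⟨a + b, by simp⟩
  | smul a p _ hp =>
    obtain ⟨b, rfl⟩ := hp
    exact ⟨a * b, by simp [smul_eq_C_mul]⟩

end Hermite

/-! ### Hypercontractivity by induction on the order of the chaos -/

section Hypercontractivity

lemma add_one_mul_pow_mul_le {u w : ℝ} (hu : 0 ≤ u) (hw : 0 ≤ w) (n : ℕ) :
    (n + 1) * (u ^ n * w) ≤ n * u ^ (n + 1) + w ^ (n + 1) := by
  induction n with
  | zero => simp
  | succ n ih =>
    have h1 := mul_le_mul_of_nonneg_left ih hw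
    have h2 : 0 ≤ (n + 1) * (u ^ n * (u - w) ^ 2) := by positivity
    push_cast
    have e : (n : ℝ) * u ^ (n + 2) + u ^ (n + 2) + w ^ (n + 2) - (n + 2) * (u ^ (n + 1) * w)
      = w * (n * u ^ (n + 1) + w ^ (n + 1)) - w * ((n + 1) * (u ^ n * w))
        + (n + 1) * (u ^ n * (u - w) ^ 2) := by ring
    have e2 : (n + 1 : ℝ) * u ^ (n + 2) = n * u ^ (n + 2) + u ^ (n + 2) := by ring
    rw [show n + 1 + 1 = n + 2 by ring, e2, show (n : ℝ) + 1 + 1 = n + 2 by ring]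
    linarith

variable [Fintype σ] {E : MvPolynomial σ ℝ →ₗ[ℝ] ℝ}

/-- Integrate `∑ Γ(U^n F_a, F_a)` by parts, where `U = ∑ F_a²`. Differentiating `F_a` gives the
gradient term once; differentiating `U^n` gives at most `2n` times that term, by pointwise
Cauchy–Schwarz. -/
lemma IsGaussianExpectation.mul_map_pow_sum_sq_le (hE : IsGaussianExpectation E) {ι : Type}
    [Fintype ι] {q : ℝ} {F : ι → MvPolynomial σ ℝ}
    (hF : ∀ a, ornsteinUhlenbeck (F a) = -(q • F a)) (n : ℕ) :
    q * E ((∑ a, F a ^ 2) ^ (n + 1)) ≤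
      (2 * n + 1) * E ((∑ a, F a ^ 2) ^ n * ∑ b : ι × σ, pderiv b.2 (F b.1) ^ 2) := by
  set U := ∑ a, F a ^ 2 with hU
  have h1 : q * E (U ^ (n + 1)) = E (∑ a, carreDuChamp (U ^ n * F a) (F a)) := by
    rw [map_sum]
    simp only [hE.map_carreDuChamp_of_eigen _ (hF _)]
    rw [← Finset.mul_sum, ← map_sum]
    congr 2
    rw [pow_succ]
    nth_rewrite 2 [hU]
    rw [Finset.mul_sum]
    exact Finset.sum_congr rfl fun a _ => by ring
  rw [h1, ← smul_eq_mul, ← map_smul]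
  refine hE.mono fun x => ?_
  obtain ⟨S, hS⟩ : ∃ S : σ → MvPolynomial σ ℝ, ∀ i, S i = ∑ a, F a * pderiv i (F a) :=
    ⟨_, fun _ => rfl⟩
  have hdU : ∀ i, pderiv i U = 2 * S i := fun i => by
    rw [hS, hU, map_sum, Finset.mul_sum]
    exact Finset.sum_congr rfl fun a _ => by rw [pderiv_pow]; simp; ring
  clear_value U
  -- The truncated exponent `n - 1` is harmless at `n = 0` because of the factor `n`.
  have h2 : ∑ a, carreDuChamp (U ^ n * F a) (F a)
      = U ^ n * (∑ b : ι × σ, pderiv b.2 (F b.1) ^ 2)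
        + (n : MvPolynomial σ ℝ) * U ^ (n - 1) * ∑ i, 2 * S i ^ 2 := by
    rw [Fintype.sum_prod_type]
    simp only [carreDuChamp_mul_left, Finset.sum_add_distrib, ← Finset.mul_sum]
    refine congrArg₂ (· + ·) ?_ ?_
    · refine congrArg (U ^ n * ·) ?_
      exact Finset.sum_congr rfl fun a _ => Finset.sum_congr rfl fun i _ => (sq _).symm
    · simp only [carreDuChamp, Finset.mul_sum, pderiv_pow, hdU]
      rw [Finset.sum_comm]
      refine Finset.sum_congr rfl fun i _ => ?_
      rw [sq]
      nth_rewrite 3 [hS]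
      rw [Finset.mul_sum, Finset.mul_sum, Finset.mul_sum]
      exact Finset.sum_congr rfl fun a _ => by ring
  rw [h2]
  simp only [hS, map_add, map_mul, map_pow, map_sum, map_natCast, smul_eval, map_ofNat]
  rw [hU]
  simp only [map_sum, map_pow]
  rw [Fintype.sum_prod_type_right]
  set u := ∑ a, eval x (F a) ^ 2
  have hu : 0 ≤ u := by positivity
  have hCS : ∑ i, 2 * (∑ a, eval x (F a) * eval x (pderiv i (F a))) ^ 2
      ≤ 2 * (u * ∑ i, ∑ a, eval x (pderiv i (F a)) ^ 2) := by
    rw [Finset.mul_sum, Finset.mul_sum]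
    gcongr with i
    exact Finset.sum_mul_sq_le_sq_mul_sq _ _ _
  set v := ∑ i, ∑ a, eval x (pderiv i (F a)) ^ 2
  have h3 : (n : ℝ) * u ^ (n - 1) * ∑ i, 2 * (∑ a, eval x (F a) * eval x (pderiv i (F a))) ^ 2
      ≤ n * u ^ (n - 1) * (2 * (u * v)) := by gcongr
  have h4 : (n : ℝ) * u ^ (n - 1) * (2 * (u * v)) = 2 * n * (u ^ n * v) := by
    rcases n with _ | n
    · simp
    · simp only [Nat.add_sub_cancel]; ring
  linarith

/-- Hypercontractivity of even moments on a fixed chaos, for vectors of polynomials. -/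
theorem IsGaussianExpectation.map_pow_sum_sq_le (hE : IsGaussianExpectation E) {ι : Type}
    [Fintype ι] {q : ℕ} {F : ι → MvPolynomial σ ℝ} (hF : ∀ a, F a ∈ chaos σ q) (n : ℕ) :
    E ((∑ a, F a ^ 2) ^ (n + 1)) ≤
      (2 * n + 1) ^ (q * (n + 1)) * E (∑ a, F a ^ 2) ^ (n + 1) := by
  induction q generalizing ι with
  | zero =>
    choose c hc using fun a => exists_eq_C_of_mem_chaos_zero (hF a)
    have : ∑ a, F a ^ 2 = C (∑ a, c a ^ 2) := by simp [hc]
    rw [this, ← map_pow, hE.map_C, hE.map_C]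
    simp
  | succ q ih =>
    have hL := fun a => ornsteinUhlenbeck_of_mem_chaos (hF a)
    have hstep := hE.mul_map_pow_sum_sq_le hL n
    -- Differentiation lowers the chaos by one but turns the family into one indexed by `ι × σ`;
    -- hence the statement for vectors.
    have hV := ih (ι := ι × σ) (F := fun b => pderiv b.2 (F b.1))
      (fun b => pderiv_mem_chaos (hF b.1) b.2)
    have hEV : E (∑ b : ι × σ, pderiv b.2 (F b.1) ^ 2) = (q + 1 : ℝ) * E (∑ a, F a ^ 2) := by
      rw [Fintype.sum_prod_type, map_sum, map_sum, Finset.mul_sum]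
      refine Finset.sum_congr rfl fun a _ => ?_
      have := hE.map_carreDuChamp_of_eigen (F a) (hL a)
      rw [← sq] at this
      push_cast at this
      rw [← this, carreDuChamp]
      simp only [sq]
    rw [hEV] at hV
    set U := ∑ a, F a ^ 2
    set V := ∑ b : ι × σ, pderiv b.2 (F b.1) ^ 2
    have hq : (0 : ℝ) < q + 1 := by positivity
    set K : ℝ := (2 * n + 1) / (q + 1) with hK
    have hK0 : 0 ≤ K := by positivity
    have h1 : E (U ^ (n + 1)) ≤ K * E (U ^ n * V) := by
      rw [hK, div_mul_eq_mul_div, le_div_iff₀ hq]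
      push_cast at hstep
      linarith
    -- Weighted AM–GM with `u = U` and `w = K V`. The term `n E U^(n+1)` is then absorbed by `n + 1`
    -- copies of `h1`.
    have h2 : (n + 1) * (K * E (U ^ n * V)) ≤ n * E (U ^ (n + 1)) + K ^ (n + 1) * E (V ^ (n + 1)) := by
      have := hE.mono (p := ((n + 1 : ℝ) * K) • (U ^ n * V))
        (r := (n : ℝ) • U ^ (n + 1) + K ^ (n + 1) • V ^ (n + 1)) fun x => by
          simp only [smul_eval, map_add, map_mul, map_pow]
          have hu : 0 ≤ eval x U := by
            simp only [U, map_sum, map_pow]; positivity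
          have hv : 0 ≤ eval x V := by
            simp only [V, map_sum, map_pow]; positivity
          have := add_one_mul_pow_mul_le hu (mul_nonneg hK0 hv) n
          rw [mul_pow] at this
          linarith
      simp only [map_add, map_smul, smul_eq_mul] at this
      linarith
    have h3 : E (U ^ (n + 1)) ≤ K ^ (n + 1) * E (V ^ (n + 1)) := by
      have := mul_le_mul_of_nonneg_left h1 (show (0 : ℝ) ≤ n + 1 by positivity)
      linarith
    calc E (U ^ (n + 1)) ≤ K ^ (n + 1) * E (V ^ (n + 1)) := h3
      _ ≤ K ^ (n + 1) * ((2 * n + 1) ^ (q * (n + 1)) * ((q + 1) * E U) ^ (n + 1)) := by gcongr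
      _ = (2 * n + 1) ^ ((q + 1) * (n + 1)) * E U ^ (n + 1) := by
        rw [hK, add_mul q 1, pow_add, mul_pow, div_pow, one_mul, pow_add]
        field_simp
        ring

/-- Hypercontractivity of even moments on a fixed chaos. -/
theorem IsGaussianExpectation.map_pow_two_mul_le (hE : IsGaussianExpectation E) {q : ℕ}
    {f : MvPolynomial σ ℝ} (hf : f ∈ chaos σ q) (n : ℕ) :
    E (f ^ (2 * (n + 1))) ≤ (2 * n + 1) ^ (q * (n + 1)) * E (f ^ 2) ^ (n + 1) := by
  have := hE.map_pow_sum_sq_le (ι := Unit) (F := fun _ => f) (fun _ => hf) n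
  simpa [← pow_mul] using this

end Hypercontractivity

end GaussianPolynomial

namespace GaussianPolynomial

open MvPolynomial

variable {σ : Type}

/-! ### Even eigenvector expansion of squares -/

section Parity

/-- The span of the homogeneous polynomials whose degree is at most `q` and has the parity of
`q`. -/
noncomputable def paritySpan (σ : Type) (q : ℕ) : Submodule ℝ (MvPolynomial σ ℝ) :=
  Submodule.span ℝ {p | ∃ i j, i + 2 * j = q ∧ p.IsHomogeneous i}

lemma mul_mem_paritySpan {q r : ℕ} {f g : MvPolynomial σ ℝ} (hf : f ∈ paritySpan σ q)
    (hg : g ∈ paritySpan σ r) : f * g ∈ paritySpan σ (q + r) := by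
  have h := Submodule.mul_mem_mul hf hg
  rw [paritySpan, paritySpan, Submodule.span_mul_span] at h
  refine Submodule.span_mono ?_ h
  rintro _ ⟨p, ⟨i, j, rfl, hp⟩, r, ⟨i', j', rfl, hr⟩, rfl⟩
  exact ⟨i + i', j + j', by ring, hp.mul hr⟩

variable [Fintype σ]

lemma linearForm_isHomogeneous (c : σ → ℝ) : (linearForm c).IsHomogeneous 1 :=
  IsHomogeneous.sum _ _ _ fun i _ => by
    simpa using (isHomogeneous_C σ (c i)).mul (isHomogeneous_X ℝ i)

/-- The coefficients of `H_q` vanish in degrees of the parity opposite to `q`. This parity excludes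
odd eigenvalues from the expansion of `f²`, which is what yields the factor `q - 1` below. -/
lemma hermiteForm_mem_paritySpan (q : ℕ) (c : σ → ℝ) : hermiteForm q c ∈ paritySpan σ q := by
  rw [hermiteForm, Polynomial.aeval_eq_sum_range, Polynomial.natDegree_hermite]
  refine Submodule.sum_mem _ fun i hi => ?_
  rw [← Int.cast_smul_eq_zsmul ℝ]
  rcases Nat.even_or_odd (q + i) with h | h
  · refine Submodule.smul_mem _ _ (Submodule.subset_span ⟨i, (q - i) / 2, ?_, ?_⟩)
    · rw [Finset.mem_range] at hi
      obtain ⟨m, hm⟩ := h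
      omega
    · simpa using (linearForm_isHomogeneous c).pow i
  · rw [Polynomial.coeff_hermite_of_odd_add h]
    simp

lemma chaos_le_paritySpan (q : ℕ) : chaos σ q ≤ paritySpan σ q := by
  rw [chaos, Submodule.span_le]
  rintro _ ⟨c, -, rfl⟩
  exact hermiteForm_mem_paritySpan q c

/-- The constants for `j = 0`, and the eigenspace of the Ornstein–Uhlenbeck operator for the
eigenvalue `-2j` for `j > 0`. -/
noncomputable def evenEigenspace (σ : Type) [Fintype σ] (j : ℕ) :
    Submodule ℝ (MvPolynomial σ ℝ) :=
  if j = 0 then Submodule.span ℝ {1}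
  else Module.End.eigenspace (ornsteinUhlenbeck (σ := σ)) (-(2 * j : ℝ))

lemma ornsteinUhlenbeck_of_mem_evenEigenspace {j : ℕ} {p : MvPolynomial σ ℝ}
    (hp : p ∈ evenEigenspace σ j) : ornsteinUhlenbeck p = -((2 * j : ℝ) • p) := by
  rw [evenEigenspace] at hp
  split_ifs at hp with h
  · obtain ⟨c, rfl⟩ := Submodule.mem_span_singleton.1 hp
    simp [h, ornsteinUhlenbeck_apply]
  · rw [Module.End.mem_eigenspace_iff.1 hp, neg_smul]

lemma isHomogeneous_sum_pderiv_pderiv {p : MvPolynomial σ ℝ} {n : ℕ} (hp : p.IsHomogeneous n) :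
    (∑ i, pderiv i (pderiv i p)).IsHomogeneous (n - 2) :=
  IsHomogeneous.sum _ _ _ fun i _ => by
    simpa [Nat.sub_sub] using (hp.pderiv (i := i)).pderiv (i := i)

/-- By Euler's identity `L p = Δp - 2(n+1) p`, and `Δp` is a sum of eigenvectors `μ_j` with `j ≤ n`
by induction. Dividing `μ_j` by the nonzero gap `2(n+1) - 2j` gives `v` with `L v = Δp - 2(n+1) v`,
so `p - v` is an eigenvector for `-2(n+1)`. -/
lemma mem_iSup_evenEigenspace_of_isHomogeneous {n : ℕ} {p : MvPolynomial σ ℝ}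
    (hp : p.IsHomogeneous (2 * n)) : p ∈ ⨆ j ∈ Finset.range (n + 1), evenEigenspace σ j := by
  induction n generalizing p with
  | zero =>
    refine Submodule.mem_iSup_of_mem 0 (Submodule.mem_iSup_of_mem (by simp) ?_)
    rw [evenEigenspace, if_pos rfl, Submodule.mem_span_singleton]
    rw [mul_zero, ← totalDegree_zero_iff_isHomogeneous, totalDegree_eq_zero_iff_eq_C] at hp
    exact ⟨coeff 0 p, by rw [smul_eq_C_mul, mul_one, ← hp]⟩
  | succ n ih =>
    obtain ⟨μ, hμ⟩ := (Submodule.mem_iSup_finset_iff_exists_sum _ _).1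
      (ih (p := ∑ i, pderiv i (pderiv i p)) (isHomogeneous_sum_pderiv_pderiv hp))
    have hL : ornsteinUhlenbeck p = ∑ j ∈ Finset.range (n + 1), (μ j : MvPolynomial σ ℝ)
        - (2 * (n + 1) : ℝ) • p := by
      rw [hμ, ornsteinUhlenbeck_apply, Finset.sum_sub_distrib, hp.sum_X_mul_pderiv]
      congr 1
      rw [← Nat.cast_smul_eq_nsmul ℝ]
      push_cast
      rfl
    set v := ∑ j ∈ Finset.range (n + 1), (1 / (2 * (n + 1) - 2 * j) : ℝ) • (μ j : MvPolynomial σ ℝ)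
      with hv
    have hvmem : v ∈ ⨆ j ∈ Finset.range (n + 2), evenEigenspace σ j := by
      refine Submodule.sum_mem _ fun j hj => Submodule.smul_mem _ _ ?_
      refine Submodule.mem_iSup_of_mem j (Submodule.mem_iSup_of_mem ?_ (μ j).2)
      rw [Finset.mem_range] at hj ⊢
      omega
    have hLv : ornsteinUhlenbeck v = ∑ j ∈ Finset.range (n + 1), (μ j : MvPolynomial σ ℝ)
        - (2 * (n + 1) : ℝ) • v := by
      rw [hv, map_sum, Finset.smul_sum, ← Finset.sum_sub_distrib]
      refine Finset.sum_congr rfl fun j hj => ?_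
      rw [map_smul, ornsteinUhlenbeck_of_mem_evenEigenspace (μ j).2, ← neg_smul, smul_smul,
        smul_smul]
      have hj' : (2 * (n + 1) - 2 * j : ℝ) ≠ 0 := by
        rw [Finset.mem_range] at hj
        have : (j : ℝ) < n + 1 := by exact_mod_cast hj
        linarith
      obtain ⟨d, hd⟩ : ∃ d : ℝ, d = 2 * (n + 1) - 2 * j := ⟨_, rfl⟩
      have hd' : d + 2 * j = 2 * (n + 1) := by rw [hd]; ring
      rw [← hd] at hj' ⊢
      nth_rewrite 2 [← one_smul ℝ (μ j : MvPolynomial σ ℝ)]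
      rw [← sub_smul]
      congr 1
      rw [← hd']
      field_simp
      ring
    rw [← sub_add_cancel p v]
    refine add_mem (Submodule.mem_iSup_of_mem (n + 1) (Submodule.mem_iSup_of_mem (by simp) ?_))
      hvmem
    rw [evenEigenspace, if_neg (by omega), Module.End.mem_eigenspace_iff, map_sub, hL, hLv]
    push_cast
    rw [neg_smul, smul_sub]
    abel

lemma paritySpan_le_iSup_evenEigenspace (q : ℕ) :
    paritySpan σ (2 * q) ≤ ⨆ j ∈ Finset.range (q + 1), evenEigenspace σ j := by
  rw [paritySpan, Submodule.span_le]
  rintro p ⟨i, j, hij, hp⟩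
  obtain rfl : i = 2 * (q - j) := by omega
  refine (biSup_mono fun a ha => ?_ :
    ⨆ a ∈ Finset.range (q - j + 1), evenEigenspace σ a ≤ _)
      (mem_iSup_evenEigenspace_of_isHomogeneous hp)
  rw [Finset.mem_range] at ha ⊢
  omega

end Parity

/-! ### Fourth-moment control of the carré du champ and the moment recursion -/

namespace IsGaussianExpectation

variable [Fintype σ] {E : MvPolynomial σ ℝ →ₗ[ℝ] ℝ}

lemma map_sum_smul_mul_sum_smul (hE : IsGaussianExpectation E) {g : ℕ → MvPolynomial σ ℝ}
    (hg : ∀ j, ornsteinUhlenbeck (g j) = -((2 * j : ℝ) • g j)) (s : Finset ℕ) (a b : ℕ → ℝ) :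
    E ((∑ j ∈ s, a j • g j) * ∑ j ∈ s, b j • g j) = ∑ j ∈ s, a j * b j * E (g j ^ 2) := by
  rw [Finset.sum_mul_sum, map_sum]
  refine Finset.sum_congr rfl fun i hi => ?_
  rw [map_sum, Finset.sum_eq_single_of_mem i hi]
  · rw [smul_mul_smul_comm, map_smul, smul_eq_mul, sq]
  · intro j _ hj
    rw [smul_mul_smul_comm, map_smul, hE.map_mul_eq_zero (hg i) (hg j), smul_zero]
    simpa using fun h => hj h.symm

/-- Variance bound for the carré du champ of an element of a fixed chaos. -/
theorem map_carreDuChamp_sq_sub_le (hE : IsGaussianExpectation E) {q : ℕ}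
    {f : MvPolynomial σ ℝ} (hf : f ∈ chaos σ q) :
    E (carreDuChamp f f ^ 2) - (q * E (f ^ 2)) ^ 2 ≤
      (q - 1) * (E (f ^ 2 * carreDuChamp f f) - q * E (f ^ 2) ^ 2) := by
  have hf2 : f ^ 2 ∈ ⨆ j ∈ Finset.range (q + 1), evenEigenspace σ j := by
    refine paritySpan_le_iSup_evenEigenspace q ?_
    rw [sq, two_mul]
    exact mul_mem_paritySpan (chaos_le_paritySpan q hf) (chaos_le_paritySpan q hf)
  obtain ⟨μ, hμ⟩ := (Submodule.mem_iSup_finset_iff_exists_sum _ _).1 hf2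
  set g : ℕ → MvPolynomial σ ℝ := fun j => μ j
  have hg : ∀ j, ornsteinUhlenbeck (g j) = -((2 * j : ℝ) • g j) := fun j =>
    ornsteinUhlenbeck_of_mem_evenEigenspace (μ j).2
  obtain ⟨c, hc⟩ : ∃ c : ℝ, c • (1 : MvPolynomial σ ℝ) = g 0 := by
    have : g 0 ∈ evenEigenspace σ 0 := (μ 0).2
    rw [evenEigenspace, if_pos rfl, Submodule.mem_span_singleton] at this
    exact this
  have hsum : f ^ 2 = ∑ j ∈ Finset.range (q + 1), (1 : ℝ) • g j := by
    simp only [one_smul]; exact hμ.symm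
  -- This is `2Γ = L(f²) - 2 f L f = L(f²) + 2q f²`, expanded in the `g j`.
  have hΓ : carreDuChamp f f = ∑ j ∈ Finset.range (q + 1), ((q : ℝ) - j) • g j := by
    have h1 := ornsteinUhlenbeck_mul f f
    rw [← sq, ornsteinUhlenbeck_of_mem_chaos hf, hsum, map_sum] at h1
    have h2 : (2 : ℝ) • carreDuChamp f f =
        (2 : ℝ) • ∑ j ∈ Finset.range (q + 1), ((q : ℝ) - j) • g j := by
      have e : (2 : ℝ) • carreDuChamp f f = 2 * carreDuChamp f f := by
        rw [smul_eq_C_mul, map_ofNat]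
      have e2 : f * -((q : ℝ) • f) = -((q : ℝ) • ∑ j ∈ Finset.range (q + 1), (1 : ℝ) • g j) := by
        rw [← hsum, mul_neg, mul_smul_comm, sq]
      rw [e2] at h1
      rw [e, ← sub_eq_iff_eq_add'.2 h1, Finset.smul_sum, Finset.smul_sum,
        ← Finset.sum_neg_distrib, ← Finset.sum_add_distrib, ← Finset.sum_sub_distrib]
      refine Finset.sum_congr rfl fun j _ => ?_
      simp only [map_smul, hg]
      module
    exact smul_right_injective _ (two_ne_zero' ℝ) h2
  have hEg : ∀ j, 1 ≤ j → E (g j) = 0 := fun j hj => by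
    have h0 : ornsteinUhlenbeck (1 : MvPolynomial σ ℝ) = -((0 : ℝ) • 1) := by
      simp [ornsteinUhlenbeck_apply]
    have := hE.map_mul_eq_zero h0 (hg j) (by
      have : (1 : ℝ) ≤ j := by exact_mod_cast hj
      linarith)
    rwa [one_mul] at this
  have hEf : E (f ^ 2) = c := by
    rw [hsum, map_sum, Finset.sum_range_succ', Finset.sum_eq_zero fun j _ => ?_]
    · rw [← hc]; simp [hE.map_one]
    · simp [hEg (j + 1) (by omega)]
  have hG0 : E (g 0 ^ 2) = c ^ 2 := by
    rw [← hc, smul_pow, one_pow, map_smul, hE.map_one, smul_eq_mul, mul_one]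
  have hG : ∀ j, 0 ≤ E (g j ^ 2) := fun j => hE.nonneg _ fun x => by rw [map_pow]; positivity
  rw [hEf, sq (carreDuChamp f f), hΓ, hsum, hE.map_sum_smul_mul_sum_smul hg,
    hE.map_sum_smul_mul_sum_smul hg, Finset.sum_range_succ', Finset.sum_range_succ', hG0]
  -- The `j = 0` terms are exactly the subtracted squares of means; for `1 ≤ j ≤ q`, `(q - j)² ≤ (q
  -- - 1)(q - j)`.
  have key : ∑ k ∈ Finset.range q, ((q : ℝ) - ↑(k + 1)) * (q - ↑(k + 1)) * E (g (k + 1) ^ 2)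
      ≤ (q - 1) * ∑ k ∈ Finset.range q, 1 * ((q : ℝ) - ↑(k + 1)) * E (g (k + 1) ^ 2) := by
    rw [Finset.mul_sum]
    refine Finset.sum_le_sum fun k hk => ?_
    rw [Finset.mem_range] at hk
    have h1 : (0 : ℝ) ≤ q - ↑(k + 1) := sub_nonneg.2 (by exact_mod_cast hk)
    have h2 : ((q : ℝ) - ↑(k + 1)) ≤ q - 1 := by push_cast; linarith [(k.cast_nonneg : (0 : ℝ) ≤ k)]
    have := mul_le_mul_of_nonneg_right h2 (mul_nonneg h1 (hG (k + 1)))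
    linarith
  rw [Nat.cast_zero, sub_zero]
  linarith

/-- Integration by parts for the pair `f^(k+1)`, `f`, with the chain rule for `Γ`. -/
lemma mul_map_pow_add_two (hE : IsGaussianExpectation E) {q : ℕ} {f : MvPolynomial σ ℝ}
    (hf : f ∈ chaos σ q) (k : ℕ) :
    q * E (f ^ (k + 2)) = (k + 1) * E (f ^ k * carreDuChamp f f) := by
  have h := hE.map_carreDuChamp_of_eigen (f ^ (k + 1)) (ornsteinUhlenbeck_of_mem_chaos hf)
  rw [carreDuChamp_pow_left, ← pow_succ] at h
  rw [← h, ← nsmul_eq_mul, map_nsmul, nsmul_eq_mul]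
  push_cast
  rfl

lemma map_eq_zero_of_mem_chaos (hE : IsGaussianExpectation E) {q : ℕ} (hq : 1 ≤ q)
    {f : MvPolynomial σ ℝ} (hf : f ∈ chaos σ q) : E f = 0 := by
  have h := hE.map_carreDuChamp_of_eigen 1 (ornsteinUhlenbeck_of_mem_chaos hf)
  have hq0 : (q : ℝ) ≠ 0 := by positivity
  simpa [carreDuChamp, hq0] using h.symm

section Moments

variable {q : ℕ} {f : MvPolynomial σ ℝ}

/-- The centred carré du champ has second moment controlled by the fourth cumulant. -/
lemma map_sq_carreDuChamp_sub_le (hE : IsGaussianExpectation E)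
    (hf : f ∈ chaos σ q) (h1 : E (f ^ 2) = 1) :
    E ((carreDuChamp f f - C (q : ℝ)) ^ 2) ≤ q * (q - 1) / 3 * (E (f ^ 4) - 3) := by
  have hv := hE.map_carreDuChamp_sq_sub_le hf
  -- The cases `k = 2` and `k = 0` give `E(f² Γ) = q E f⁴ / 3` and `E Γ = q`.
  have h4 := hE.mul_map_pow_add_two hf 2
  have h2 := hE.mul_map_pow_add_two hf 0
  rw [h1] at hv
  have e : (carreDuChamp f f - C (q : ℝ)) ^ 2
      = carreDuChamp f f ^ 2 - (2 * q : ℝ) • carreDuChamp f f + C ((q : ℝ) ^ 2) := by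
    rw [smul_eq_C_mul]
    simp only [map_mul, map_pow, map_ofNat]
    ring
  rw [e, map_add, map_sub, map_smul, hE.map_C, smul_eq_mul]
  norm_num [h1] at h2 h4
  rw [← h2]
  have : E (f ^ 2 * carreDuChamp f f) = q * E (f ^ 4) / 3 := by linarith
  rw [this] at hv
  linarith

lemma three_le_map_pow_four (hE : IsGaussianExpectation E) (hq : 2 ≤ q)
    (hf : f ∈ chaos σ q) (h1 : E (f ^ 2) = 1) : 3 ≤ E (f ^ 4) := by
  have h := hE.map_sq_carreDuChamp_sub_le hf h1
  have h0 := hE.nonneg ((carreDuChamp f f - C (q : ℝ)) ^ 2) fun x => by rw [map_pow]; positivity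
  have hq' : (2 : ℝ) ≤ q := by exact_mod_cast hq
  have hpos : 0 < (q : ℝ) * (q - 1) / 3 := by
    have : (0 : ℝ) < q - 1 := by linarith
    positivity
  have := nonneg_of_mul_nonneg_right (h0.trans h) hpos
  linarith

lemma map_pow_two_mul_le_of_map_sq_eq_one (hE : IsGaussianExpectation E) (hf : f ∈ chaos σ q)
    (h1 : E (f ^ 2) = 1) (k : ℕ) : E (f ^ (2 * k)) ≤ (2 * k - 1 : ℝ) ^ (q * k) := by
  rcases k with _ | k
  · simp [hE.map_one]
  · have := hE.map_pow_two_mul_le hf k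
    rw [h1, one_pow, mul_one] at this
    convert this using 2
    push_cast; ring

/-- The defect equals `((k+1)/q) E(f^k (Γ - q))`; apply Cauchy–Schwarz, then hypercontractivity to
`f^(2k)` and the fourth-moment bound to `Γ - q`. -/
lemma abs_map_pow_add_two_sub_le (hE : IsGaussianExpectation E) (hq : 1 ≤ q)
    (hf : f ∈ chaos σ q) (h1 : E (f ^ 2) = 1) (k : ℕ) :
    |E (f ^ (k + 2)) - (k + 1) * E (f ^ k)| ≤
      (k + 1) * (√((2 * k - 1 : ℝ) ^ (q * k)) *
        (√(((q : ℝ) - 1) / (3 * q)) * √(E (f ^ 4) - 3))) := by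
  have hq0 : (0 : ℝ) < q := by exact_mod_cast hq
  have hq1 : (1 : ℝ) ≤ q := by exact_mod_cast hq
  have hR := hE.map_sq_carreDuChamp_sub_le hf h1
  set R := carreDuChamp f f - C (q : ℝ) with hRdef
  have hm := hE.mul_map_pow_add_two hf k
  have e : E (f ^ (k + 2)) - (k + 1) * E (f ^ k) = (k + 1) / q * E (f ^ k * R) := by
    rw [hRdef, mul_sub, map_sub, mul_comm _ (C _), ← smul_eq_C_mul, map_smul, smul_eq_mul]
    field_simp
    linarith
  have hCS := hE.sq_map_mul_le (f ^ k) R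
  rw [← pow_mul, mul_comm k 2] at hCS
  have hM := hE.map_pow_two_mul_le_of_map_sq_eq_one hf h1 k
  have hR0 : 0 ≤ E (R ^ 2) := hE.nonneg _ fun x => by rw [map_pow]; positivity
  have hM0 : 0 ≤ E (f ^ (2 * k)) := hE.nonneg _ fun x => by rw [map_pow, pow_mul]; positivity
  have hM1 := hM0.trans hM
  have h2 : |E (f ^ k * R)| ≤
      √((2 * k - 1 : ℝ) ^ (q * k)) * (q * (√(((q : ℝ) - 1) / (3 * q)) * √(E (f ^ 4) - 3))) := by
    have hqq : (q : ℝ) = √((q : ℝ) ^ 2) := (Real.sqrt_sq hq0.le).symm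
    have hq' : (0 : ℝ) ≤ ((q : ℝ) - 1) / (3 * q) := div_nonneg (by linarith) (by linarith)
    have e2 : (q : ℝ) * (√(((q : ℝ) - 1) / (3 * q)) * √(E (f ^ 4) - 3))
        = √(q * (q - 1) / 3 * (E (f ^ 4) - 3)) := by
      rw [← Real.sqrt_mul hq']
      nth_rewrite 1 [hqq]
      rw [← Real.sqrt_mul (by positivity)]
      congr 1
      field_simp
    rw [e2, ← Real.sqrt_mul hM1]
    refine Real.abs_le_sqrt (hCS.trans ?_)
    gcongr
  rw [e, abs_mul, abs_of_nonneg (by positivity)]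
  calc (k + 1 : ℝ) / q * |E (f ^ k * R)| ≤ (k + 1) / q * (√((2 * k - 1 : ℝ) ^ (q * k)) *
        (q * (√(((q : ℝ) - 1) / (3 * q)) * √(E (f ^ 4) - 3)))) := by gcongr
    _ = _ := by field_simp

end Moments

end IsGaussianExpectation

/-- Solution of the recursive inequality between the moment defects. -/
lemma abs_sub_le_of_moment_recursion {a γ : ℕ → ℝ} {τ : ℝ} {q : ℕ} (hτ : 0 ≤ τ) (hq : 1 ≤ q)
    (ha1 : a 1 = γ 1) (ha2 : a 2 = γ 2) (hγ : ∀ k, γ (k + 2) = (k + 1) * γ k)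
    (ha : ∀ k : ℕ, |a (k + 2) - (k + 1) * a k| ≤ (k + 1) * (√((2 * k - 1 : ℝ) ^ (q * k)) * τ))
    (n : ℕ) : |a (n + 3) - γ (n + 3)| ≤
      (n + 2) * (2 : ℝ) ^ (n + 1 - 1 / 2 : ℝ) * √((2 * n + 1 : ℝ) ^ (q * (n + 1))) * τ := by
  have step : ∀ k : ℕ, |a (k + 2) - γ (k + 2)| ≤
      (k + 1) * (|a k - γ k| + √((2 * k - 1 : ℝ) ^ (q * k)) * τ) := fun k => by
    have e : a (k + 2) - γ (k + 2) = (a (k + 2) - (k + 1) * a k) + (k + 1) * (a k - γ k) := by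
      rw [hγ]; ring
    rw [e]
    refine (abs_add_le _ _).trans ?_
    rw [abs_mul, abs_of_nonneg (by positivity : (0 : ℝ) ≤ k + 1), mul_add, add_comm]
    gcongr
    exact ha k
  have hx : ∀ n : ℕ, (1 : ℝ) ≤ 2 ^ (n + 1 - 1 / 2 : ℝ) := fun n =>
    Real.one_le_rpow (by norm_num) (by linarith [(n.cast_nonneg : (0 : ℝ) ≤ n)])
  -- Each parity class starts from a vanishing defect, at index 1 or 2.
  have base : ∀ n : ℕ, a (n + 1) = γ (n + 1) → |a (n + 3) - γ (n + 3)| ≤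
      (n + 2) * (2 : ℝ) ^ (n + 1 - 1 / 2 : ℝ) * √((2 * n + 1 : ℝ) ^ (q * (n + 1))) * τ := by
    intro n hn
    have := step (n + 1)
    rw [hn, sub_self, abs_zero, zero_add] at this
    push_cast at this
    rw [show (2 * ((n : ℝ) + 1) - 1) = 2 * n + 1 by ring] at this
    refine this.trans ?_
    have h0 : 0 ≤ √((2 * n + 1 : ℝ) ^ (q * (n + 1))) * τ := by positivity
    have h1 := mul_le_mul_of_nonneg_right (hx n) h0
    have h2 := mul_le_mul_of_nonneg_left h1 (by positivity : (0 : ℝ) ≤ n + 2)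
    linarith
  induction n using Nat.twoStepInduction with
  | zero => exact base 0 ha1
  | one => exact base 1 ha2
  | more n ih _ =>
    have h := step (n + 3)
    set x := (2 : ℝ) ^ (n + 1 - 1 / 2 : ℝ) with hxdef
    have hx' : (2 : ℝ) ^ ((n + 2 : ℕ) + 1 - 1 / 2 : ℝ) = 4 * x := by
      push_cast
      rw [hxdef, show (n : ℝ) + 2 + 1 - 1 / 2 = (n + 1 - 1 / 2) + 2 by ring,
        Real.rpow_add (by norm_num)]
      norm_num; ring
    rw [hx']
    push_cast at h ⊢
    rw [show (2 * ((n : ℝ) + 3) - 1) = 2 * n + 5 by ring] at h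
    rw [show (2 * ((n : ℝ) + 2) + 1) = 2 * n + 5 by ring, show n + 2 + 1 = n + 3 by ring]
    set s := √((2 * n + 1 : ℝ) ^ (q * (n + 1)))
    set s' := √((2 * n + 5 : ℝ) ^ (q * (n + 3)))
    have hs0 : 0 ≤ s := by positivity
    -- Here `q ≥ 1` enters, through `(2n+5)² ≤ (2n+5)^(2q)`.
    have hs : (2 * n + 5) * s ≤ s' := by
      have h5 : (2 * n + 5 : ℝ) = √((2 * n + 5 : ℝ) ^ 2) := (Real.sqrt_sq (by positivity)).symm
      nth_rewrite 1 [h5]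
      rw [← Real.sqrt_mul (by positivity)]
      refine Real.sqrt_le_sqrt ?_
      calc (2 * n + 5 : ℝ) ^ 2 * (2 * n + 1) ^ (q * (n + 1))
          ≤ (2 * n + 5) ^ (2 * q) * (2 * n + 5) ^ (q * (n + 1)) := by
            gcongr
            · linarith [(n.cast_nonneg : (0 : ℝ) ≤ n)]
            · omega
            · norm_num
        _ = (2 * n + 5) ^ (q * (n + 3)) := by rw [← pow_add]; ring
    have hxx : 1 ≤ x := hx n
    have hn0 : (0 : ℝ) ≤ n := n.cast_nonneg
    -- Two steps multiply the power of two by 4. One `s'` is reserved for the new error; the old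
    -- factor `n + 2` is absorbed by `2n + 5`, using `x ≥ 1`.
    have h1 : (n + 2) * x * s ≤ (4 * x - 1) * s' := by
      calc (n + 2) * x * s ≤ (4 * x - 1) * ((2 * n + 5) * s) := by
            rw [← mul_assoc]
            exact mul_le_mul_of_nonneg_right (by nlinarith) hs0
        _ ≤ (4 * x - 1) * s' := by
            gcongr
            linarith
    have h2 := mul_le_mul_of_nonneg_right h1 hτ
    have h3 : |a (n + 3) - γ (n + 3)| + s' * τ ≤ 4 * x * s' * τ := by linarith
    have h4 := mul_le_mul_of_nonneg_left h3 (by positivity : (0 : ℝ) ≤ n + 4)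
    rw [show (n : ℝ) + 3 + 1 = n + 4 by ring] at h
    rw [show (n : ℝ) + 2 + 2 = n + 4 by ring]
    exact h.trans (h4.trans (le_of_eq (by ring)))

/-- The second summand in `momentConst` alone suffices; the first is nonnegative and is dropped. -/
lemma le_momentConst (n q : ℕ) :
    (n + 2) * (2 : ℝ) ^ (n + 1 - 1 / 2 : ℝ) * √((2 * n + 1 : ℝ) ^ (q * (n + 1))) *
      √(((q : ℝ) - 1) / (3 * q)) ≤ momentConst (n + 3) q := by
  have hs : √((2 * n + 1 : ℝ) ^ (q * (n + 1)))
      = (2 * ((n + 3 : ℕ) : ℝ) - 5) ^ (((n + 3 : ℕ) : ℝ) * q / 2 - q) := by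
    rw [Real.sqrt_eq_rpow, ← Real.rpow_natCast, ← Real.rpow_mul (by positivity)]
    push_cast
    congr 1 <;> ring
  rw [hs, momentConst]
  set r := (2 * ((n + 3 : ℕ) : ℝ) - 5) ^ (((n + 3 : ℕ) : ℝ) * q / 2 - q)
  have h1 : (((n + 3 : ℕ) : ℝ) - 1) = n + 2 := by push_cast; ring
  have h2 : (((n + 3 : ℕ) : ℝ) - 5 / 2) = n + 1 - 1 / 2 := by push_cast; ring
  rw [h1, h2, mul_right_comm]
  gcongr
  exact le_add_of_nonneg_left (Real.sqrt_nonneg _)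

theorem IsGaussianExpectation.abs_map_pow_sub_le [Fintype σ] {E : MvPolynomial σ ℝ →ₗ[ℝ] ℝ}
    (hE : IsGaussianExpectation E) {q : ℕ} {f : MvPolynomial σ ℝ} (hq : 1 ≤ q)
    (hf : f ∈ chaos σ q) (h1 : E (f ^ 2) = 1) {γ : ℕ → ℝ} (hγ0 : γ 0 = 1) (hγ1 : γ 1 = 0)
    (hγ : ∀ k, γ (k + 2) = (k + 1) * γ k) {k : ℕ} (hk : 3 ≤ k) :
    |E (f ^ k) - γ k| ≤ momentConst k q * √(E (f ^ 4) - 3) := by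
  obtain ⟨n, rfl⟩ : ∃ n, k = n + 3 := ⟨k - 3, by omega⟩
  have := abs_sub_le_of_moment_recursion (a := fun k => E (f ^ k)) (γ := γ)
    (τ := √(((q : ℝ) - 1) / (3 * q)) * √(E (f ^ 4) - 3)) (by positivity) hq
    (by simpa [hγ1] using hE.map_eq_zero_of_mem_chaos hq hf) (by simp [hγ, hγ0, h1]) hγ
    (fun k => hE.abs_map_pow_add_two_sub_le hq hf h1 k) n
  refine this.trans ?_
  rw [← mul_assoc]
  gcongr
  exact le_momentConst n q

end GaussianPolynomial

/-! ### The standard Gaussian measure as a Gaussian expectation -/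

namespace GaussianPolynomial

open MvPolynomial

lemma integrable_pow_gaussianReal (μ : ℝ) (v : NNReal) (n : ℕ) :
    Integrable (fun x : ℝ => x ^ n) (gaussianReal μ v) := by
  rcases Nat.eq_zero_or_pos n with rfl | hn
  · simp
  · exact (memLp_id_gaussianReal' (n : ENNReal) (by simp)).integrable_norm_pow' |>.mono'
      (by fun_prop) (by simp)

lemma hasDerivAt_gaussianPDFReal (x : ℝ) :
    HasDerivAt (gaussianPDFReal 0 1) (-(x * gaussianPDFReal 0 1 x)) x := by
  simp only [gaussianPDFReal_def]
  have h : HasDerivAt (fun x : ℝ => -(x - 0) ^ 2 / (2 * ((1 : NNReal) : ℝ))) (-x) x := by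
    have := (((hasDerivAt_id x).sub_const 0).pow 2).neg.div_const (2 * ((1 : NNReal) : ℝ))
    exact this.congr_deriv (by simp; ring)
  exact (h.exp.const_mul _).congr_deriv (by ring)

lemma integrable_pow_mul_gaussianPDFReal (n : ℕ) :
    Integrable (fun x : ℝ => x ^ n * gaussianPDFReal 0 1 x) := by
  have h := integrable_pow_gaussianReal 0 1 n
  rw [gaussianReal_of_var_ne_zero _ one_ne_zero,
    integrable_withDensity_iff_integrable_smul' (measurable_gaussianPDF 0 1)
      (Filter.Eventually.of_forall fun x => gaussianPDF_lt_top)] at h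
  refine h.congr (Filter.Eventually.of_forall fun x => ?_)
  simp [toReal_gaussianPDF, mul_comm]

/-- The recursion for the moments of the standard Gaussian law. -/
lemma integral_pow_succ_gaussianReal (n : ℕ) :
    ∫ x, x ^ (n + 1) ∂gaussianReal 0 1 = n * ∫ x, x ^ (n - 1) ∂gaussianReal 0 1 := by
  rw [integral_gaussianReal_eq_integral_smul one_ne_zero,
    integral_gaussianReal_eq_integral_smul one_ne_zero]
  -- Integration by parts of `x^n` against the density `φ`, using `φ' = -x φ`.
  have h := integral_mul_deriv_eq_deriv_mul_of_integrable
    (u := fun x : ℝ => x ^ n) (v := gaussianPDFReal 0 1) (u' := fun x => n * x ^ (n - 1))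
    (v' := fun x => -(x * gaussianPDFReal 0 1 x)) (fun x _ => hasDerivAt_pow n x)
    (fun x _ => hasDerivAt_gaussianPDFReal x)
    ((integrable_pow_mul_gaussianPDFReal (n + 1)).neg.congr
      (Filter.Eventually.of_forall fun x => by simp; ring))
    (((integrable_pow_mul_gaussianPDFReal (n - 1)).const_mul n).congr
      (Filter.Eventually.of_forall fun x => by simp; ring))
    (integrable_pow_mul_gaussianPDFReal n)
  rw [← integral_const_mul]
  have e1 : ∫ x : ℝ, x ^ n * -(x * gaussianPDFReal 0 1 x)
      = -∫ x : ℝ, gaussianPDFReal 0 1 x • x ^ (n + 1) := by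
    rw [← integral_neg]
    congr 1; ext x; simp; ring
  rw [e1, neg_inj] at h
  rw [h]
  congr 1; ext x; simp; ring

section Pi

variable {σ : Type} [Fintype σ]

lemma integrable_eval_pi (p : MvPolynomial σ ℝ) :
    Integrable (fun x => eval x p) (Measure.pi fun _ : σ => gaussianReal 0 1) := by
  simp only [eval_eq']
  exact integrable_finsetSum _ fun m _ =>
    (Integrable.fintype_prod fun i => integrable_pow_gaussianReal 0 1 (m i)).const_mul _

/-- The expectation of a polynomial under the standard Gaussian measure. -/
noncomputable def gaussianExpectation (σ : Type) [Fintype σ] : MvPolynomial σ ℝ →ₗ[ℝ] ℝ where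
  toFun p := ∫ x, eval x p ∂(Measure.pi fun _ : σ => gaussianReal 0 1)
  map_add' p r := by
    simp only [map_add]
    exact integral_add (integrable_eval_pi p) (integrable_eval_pi r)
  map_smul' a p := by
    simp only [smul_eval]
    exact integral_const_mul _ _

lemma gaussianExpectation_apply (p : MvPolynomial σ ℝ) : gaussianExpectation σ p
    = ∫ x, eval x p ∂(Measure.pi fun _ : σ => gaussianReal 0 1) := rfl

lemma gaussianExpectation_monomial (m : σ →₀ ℕ) (a : ℝ) :
    gaussianExpectation σ (monomial m a) = a * ∏ i, ∫ x, x ^ m i ∂gaussianReal 0 1 := by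
  rw [gaussianExpectation_apply]
  simp only [eval_monomial]
  rw [integral_const_mul]
  congr 1
  rw [← integral_fintype_prod_eq_prod (fun i (x : ℝ) => x ^ m i)]
  congr 1; ext x
  exact Finsupp.prod_fintype _ _ fun i => pow_zero _

/-- By linearity integration by parts is needed only for monomials, whose integrals factor over
coordinates; only the `i`-th factor changes, by the one-dimensional moment recursion. -/
theorem isGaussianExpectation_gaussianExpectation :
    IsGaussianExpectation (gaussianExpectation σ) where
  map_one := by simp [gaussianExpectation_apply]
  nonneg p hp := integral_nonneg hp
  map_X_mul i p := by
    classical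
    induction p using MvPolynomial.induction_on' with
    | monomial m a =>
      rw [pderiv_monomial, mul_comm, show monomial m a * X i = monomial (m + Finsupp.single i 1) a by
          rw [monomial_add_single, pow_one],
        gaussianExpectation_monomial, gaussianExpectation_monomial,
        ← Finset.mul_prod_erase _ _ (Finset.mem_univ i),
        ← Finset.mul_prod_erase _ _ (Finset.mem_univ i)]
      have h1 : (m + Finsupp.single i 1 : σ →₀ ℕ) i = m i + 1 := by simp
      have h2 : (m - Finsupp.single i 1 : σ →₀ ℕ) i = m i - 1 := by simp
      have h3 : ∀ j ∈ Finset.univ.erase i, (∫ x, x ^ (m + Finsupp.single i 1 : σ →₀ ℕ) j ∂gaussianReal 0 1)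
          = ∫ x, x ^ (m - Finsupp.single i 1 : σ →₀ ℕ) j ∂gaussianReal 0 1 := fun j hj => by
        have hj' : i ≠ j := (Finset.ne_of_mem_erase hj).symm
        simp [hj']
      rw [h1, h2, Finset.prod_congr rfl h3, integral_pow_succ_gaussianReal]
      ring
    | add p r hp hr => rw [mul_add, map_add, map_add, map_add, hp, hr]

end Pi

end GaussianPolynomial

/-! ### Linearity of an isonormal process and its finite-dimensional laws -/

section Isonormal

variable {H : Type*} [NormedAddCommGroup H] [InnerProductSpace ℝ H] {Ω : Type*}
  {mΩ : MeasurableSpace Ω} {P : Measure Ω} {X : H → Ω → ℝ}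

lemma IsIsonormal.memLp_two (hX : IsIsonormal X P) (h : H) : MemLp (X h) 2 P :=
  (hX.isGaussianProcess.hasGaussianLaw_eval h).memLp_two

/-- Linearity is forced by the covariance: the residual is orthogonal in `L²` to every `X g`, hence
to itself. -/
lemma IsIsonormal.ae_eq_sum [IsProbabilityMeasure P] (hX : IsIsonormal X P) {σ : Type} [Fintype σ] (c : σ → ℝ)
    (e : σ → H) {h : H} (hh : h = ∑ i, c i • e i) :
    X h =ᵐ[P] fun ω => ∑ i, c i * X (e i) ω := by
  have hL : ∀ g k : H, Integrable (fun ω => X g ω * X k ω) P := fun g k =>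
    (hX.memLp_two g).integrable_mul (hX.memLp_two k)
  have hmem : MemLp (fun ω => X h ω - ∑ i, c i * X (e i) ω) 2 P :=
    (hX.memLp_two h).sub (memLp_finsetSum _ fun i _ => (hX.memLp_two (e i)).const_mul (c i))
  have hcross : ∀ g, ∫ ω, X g ω * (X h ω - ∑ i, c i * X (e i) ω) ∂P = 0 := fun g => by
    have e1 : ∀ ω, X g ω * (X h ω - ∑ i, c i * X (e i) ω)
        = X g ω * X h ω - ∑ i, c i * (X g ω * X (e i) ω) := fun ω => by
      rw [mul_sub, Finset.mul_sum]
      congr 1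
      exact Finset.sum_congr rfl fun i _ => by ring
    simp only [e1]
    rw [integral_sub (hL _ _) (integrable_finsetSum _ fun i _ => (hL _ _).const_mul _),
      integral_finsetSum _ fun i _ => (hL _ _).const_mul _]
    simp only [integral_const_mul, hX.integral_mul_eq_inner]
    rw [hh]
    simp [inner_sum, inner_smul_right]
  have hcI : ∀ g, Integrable (fun ω => X g ω * (X h ω - ∑ i, c i * X (e i) ω)) P := fun g =>
    (hX.memLp_two g).integrable_mul hmem
  have hz : ∫ ω, (X h ω - ∑ i, c i * X (e i) ω) ^ 2 ∂P = 0 := by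
    have e1 : ∀ ω, (X h ω - ∑ i, c i * X (e i) ω) ^ 2
        = X h ω * (X h ω - ∑ i, c i * X (e i) ω)
          - ∑ i, c i * (X (e i) ω * (X h ω - ∑ i, c i * X (e i) ω)) := fun ω => by
      rw [sq]
      nth_rewrite 1 [sub_mul]
      rw [Finset.sum_mul]
      simp only [mul_assoc]
    simp only [e1]
    rw [integral_sub (hcI _) (integrable_finsetSum _ fun i _ => (hcI _).const_mul _),
      integral_finsetSum _ fun i _ => (hcI _).const_mul _]
    simp [integral_const_mul, hcross]
  rw [integral_eq_zero_iff_of_nonneg (fun ω => sq_nonneg _) hmem.integrable_sq] at hz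
  filter_upwards [hz] with ω hω
  have := pow_eq_zero_iff (two_ne_zero) |>.1 hω
  linarith

/-- Jointly Gaussian and uncorrelated variables are independent; each has mean zero and variance `‖e
i‖² = 1`. -/
lemma IsIsonormal.hasLaw_pi [IsProbabilityMeasure P] (hX : IsIsonormal X P) {σ : Type} [Fintype σ] {e : σ → H}
    (he : Orthonormal ℝ e) :
    HasLaw (fun ω i => X (e i) ω) (Measure.pi fun _ : σ => gaussianReal 0 1) P := by
  have hG : HasGaussianLaw (fun ω i => X (e i) ω) P := by
    have h := (hX.isGaussianProcess.comp_right e).hasGaussianLaw Finset.univ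
    exact h.map_of_measurable (ContinuousLinearMap.pi fun i =>
      ContinuousLinearMap.proj (⟨i, Finset.mem_univ i⟩ : (Finset.univ : Finset σ))) (by fun_prop)
  have hm : ∀ i, AEMeasurable (X (e i)) P := fun i => hX.isGaussianProcess.aemeasurable _
  have hcov : ∀ i j, cov[X (e i), X (e j); P] = inner ℝ (e i) (e j) := fun i j => by
    rw [covariance_eq_sub (hX.memLp_two _) (hX.memLp_two _), hX.integral_eq_zero, zero_mul,
      sub_zero, ← hX.integral_mul_eq_inner]
    rfl
  have hind : iIndepFun (fun i => X (e i)) P :=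
    hG.iIndepFun_of_covariance_eq_zero fun i j hij => by rw [hcov, he.2 hij]
  refine ⟨hG.aemeasurable, ?_⟩
  rw [(iIndepFun_iff_map_fun_eq_pi_map hm).1 hind]
  congr 1; ext1 i
  rw [(hX.isGaussianProcess.hasGaussianLaw_eval (e i)).map_eq_gaussianReal, hX.integral_eq_zero,
    ← covariance_self (hm i), hcov, real_inner_self_eq_norm_sq, he.1 i]
  simp

end Isonormal

/-! ### Convergence of moments along `L²` limits -/

section L2

open Filter Topology

variable {Ω : Type*} {mΩ : MeasurableSpace Ω} {P : Measure Ω}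

lemma integral_sq_eq_norm_sq (F : Lp ℝ 2 P) : ∫ ω, F ω ^ 2 ∂P = ‖F‖ ^ 2 := by
  rw [← real_inner_self_eq_norm_sq, L2.inner_def]
  simp [sq]

lemma integral_mul_le_sqrt_mul_sqrt {f g : Ω → ℝ} (hf0 : 0 ≤ᵐ[P] f) (hg0 : 0 ≤ᵐ[P] g)
    (hf : MemLp f 2 P) (hg : MemLp g 2 P) :
    ∫ ω, f ω * g ω ∂P ≤ √(∫ ω, f ω ^ 2 ∂P) * √(∫ ω, g ω ^ 2 ∂P) := by
  have h := integral_mul_le_Lp_mul_Lq_of_nonneg (μ := P) Real.HolderConjugate.two_two hf0 hg0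
    (by simpa using hf) (by simpa using hg)
  simpa [Real.sqrt_eq_rpow] using h

lemma integrable_pow_of_integrable_even_pow [IsProbabilityMeasure P] {f : Ω → ℝ}
    (hf : AEStronglyMeasurable f P) (h : ∀ m : ℕ, Integrable (fun ω => f ω ^ (2 * m)) P) (n : ℕ) :
    Integrable (fun ω => f ω ^ n) P := by
  refine ((integrable_const (1 : ℝ)).add (h n)).mono' (hf.pow n)
    (Eventually.of_forall fun ω => ?_)
  have e : f ω ^ (2 * n) = ‖f ω ^ n‖ ^ 2 := by rw [mul_comm, pow_mul, Real.norm_eq_abs, sq_abs]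
  simp only [Pi.add_apply, e]
  nlinarith [sq_nonneg (‖f ω ^ n‖ - 1), norm_nonneg (f ω ^ n)]

/-- Fatou's lemma for the even moments of an `L²` limit. -/
lemma integral_even_pow_le_of_tendsto {y : ℕ → Lp ℝ 2 P} {Z : Lp ℝ 2 P}
    (hy : Tendsto y atTop (𝓝 Z)) {m : ℕ} {B : ℝ}
    (hint : ∀ n, Integrable (fun ω => y n ω ^ (2 * m)) P)
    (hB : ∀ n, ∫ ω, y n ω ^ (2 * m) ∂P ≤ B) :
    Integrable (fun ω => Z ω ^ (2 * m)) P ∧ ∫ ω, Z ω ^ (2 * m) ∂P ≤ B := by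
  obtain ⟨ns, -, hns⟩ := (tendstoInMeasure_of_tendsto_Lp hy).exists_seq_tendsto_ae
  have hpos : ∀ x : ℝ, 0 ≤ x ^ (2 * m) := fun x => by rw [pow_mul]; positivity
  have hB0 : 0 ≤ B := (integral_nonneg fun ω => hpos _).trans (hB 0)
  have hle : ∫⁻ ω, ENNReal.ofReal (Z ω ^ (2 * m)) ∂P ≤ ENNReal.ofReal B := by
    calc ∫⁻ ω, ENNReal.ofReal (Z ω ^ (2 * m)) ∂P
        = ∫⁻ ω, liminf (fun i => ENNReal.ofReal (y (ns i) ω ^ (2 * m))) atTop ∂P := by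
          refine lintegral_congr_ae ?_
          filter_upwards [hns] with ω hω
          exact ((ENNReal.continuous_ofReal.tendsto _).comp (hω.pow _)).liminf_eq.symm
      _ ≤ liminf (fun i => ∫⁻ ω, ENNReal.ofReal (y (ns i) ω ^ (2 * m)) ∂P) atTop :=
          lintegral_liminf_le' fun i =>
            ((Lp.aestronglyMeasurable (y (ns i))).aemeasurable.pow_const _).ennreal_ofReal
      _ ≤ ENNReal.ofReal B := by
          refine liminf_le_of_frequently_le' (Frequently.of_forall fun i => ?_)
          rw [← ofReal_integral_eq_lintegral_ofReal (hint _) (Eventually.of_forall fun ω => hpos _)]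
          exact ENNReal.ofReal_le_ofReal (hB _)
  have hmeas : AEStronglyMeasurable (fun ω => Z ω ^ (2 * m)) P :=
    (Lp.aestronglyMeasurable Z).pow _
  have hZ : Integrable (fun ω => Z ω ^ (2 * m)) P :=
    ⟨hmeas, (hasFiniteIntegral_iff_ofReal (Eventually.of_forall fun ω => hpos _)).2
      (hle.trans_lt ENNReal.ofReal_lt_top)⟩
  refine ⟨hZ, ?_⟩
  rw [← ofReal_integral_eq_lintegral_ofReal hZ (Eventually.of_forall fun ω => hpos _)] at hle
  exact (ENNReal.ofReal_le_ofReal_iff hB0).1 hle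

/-- Along an `L²` convergent sequence with bounded even moments, all moments converge. -/
lemma tendsto_integral_pow_of_tendsto [IsProbabilityMeasure P] {y : ℕ → Lp ℝ 2 P} {Z : Lp ℝ 2 P}
    (hy : Tendsto y atTop (𝓝 Z)) {B : ℕ → ℝ}
    (hint : ∀ n m : ℕ, Integrable (fun ω => y n ω ^ (2 * m)) P)
    (hB : ∀ n m : ℕ, ∫ ω, y n ω ^ (2 * m) ∂P ≤ B m) (k : ℕ) :
    Integrable (fun ω => Z ω ^ k) P ∧
      Tendsto (fun n => ∫ ω, y n ω ^ k ∂P) atTop (𝓝 (∫ ω, Z ω ^ k ∂P)) := by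
  have hZ := fun m => integral_even_pow_le_of_tendsto hy (fun n => hint n m) (fun n => hB n m)
  have hZint := integrable_pow_of_integrable_even_pow (Lp.aestronglyMeasurable Z)
    (fun m => (hZ m).1)
  have hyint := fun n => integrable_pow_of_integrable_even_pow (Lp.aestronglyMeasurable (y n))
    (hint n)
  refine ⟨hZint k, ?_⟩
  rcases k with _ | k
  · simp
  have hmem : ∀ {f : Ω → ℝ}, AEStronglyMeasurable f P →
      (∀ m : ℕ, Integrable (fun ω => f ω ^ (2 * m)) P) → MemLp (fun ω => |f ω| ^ k) 2 P := by
    intro f hf h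
    refine (memLp_two_iff_integrable_sq (hf.norm.pow k)).2 ((h k).congr ?_)
    refine Eventually.of_forall fun ω => ?_
    simp only [Pi.pow_apply, Real.norm_eq_abs]
    rw [← pow_mul, mul_comm k 2, pow_mul, pow_mul, sq_abs]
  have hg : ∀ n, MemLp (fun ω => (k + 1 : ℝ) * (|y n ω| ^ k + |Z ω| ^ k)) 2 P := fun n =>
    ((hmem (Lp.aestronglyMeasurable _) (hint n)).add
      (hmem (Lp.aestronglyMeasurable _) fun m => (hZ m).1)).const_mul _
  -- Bound the difference of powers by `(k+1) |y - Z| (|y|^k + |Z|^k)` and apply Cauchy–Schwarz. The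
  -- 4 comes from `(u + v)² ≤ 2(u² + v²)` and two even moments at most `B k`.
  have hbound : ∀ n, |∫ ω, y n ω ^ (k + 1) ∂P - ∫ ω, Z ω ^ (k + 1) ∂P| ≤
      ‖y n - Z‖ * √((k + 1) ^ 2 * (4 * B k)) := by
    intro n
    have hd : MemLp (fun ω => |y n ω - Z ω|) 2 P := ((Lp.memLp (y n)).sub (Lp.memLp Z)).norm
    have hdn : ∫ ω, |y n ω - Z ω| ^ 2 ∂P = ‖y n - Z‖ ^ 2 := by
      rw [← integral_sq_eq_norm_sq]
      refine integral_congr_ae ?_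
      filter_upwards [Lp.coeFn_sub (y n) Z] with ω hω
      rw [hω, sq_abs, Pi.sub_apply]
    rw [← integral_sub (hyint n _) (hZint _)]
    refine (abs_integral_le_integral_abs).trans ?_
    calc ∫ ω, |y n ω ^ (k + 1) - Z ω ^ (k + 1)| ∂P
        ≤ ∫ ω, |y n ω - Z ω| * ((k + 1 : ℝ) * (|y n ω| ^ k + |Z ω| ^ k)) ∂P := by
          refine integral_mono ((hyint n _).sub (hZint _)).abs (hd.integrable_mul (hg n))
            fun ω => ?_
          have h1 := abs_pow_sub_pow_le (y n ω) (Z ω) (k + 1)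
          have h2 : max |y n ω| |Z ω| ^ k ≤ |y n ω| ^ k + |Z ω| ^ k := by
            rcases max_choice |y n ω| |Z ω| with h | h <;> rw [h]
            · exact le_add_of_nonneg_right (by positivity)
            · exact le_add_of_nonneg_left (by positivity)
          refine h1.trans ?_
          rw [Nat.add_sub_cancel, mul_assoc]
          push_cast
          gcongr
      _ ≤ √(∫ ω, |y n ω - Z ω| ^ 2 ∂P) *
          √(∫ ω, ((k + 1 : ℝ) * (|y n ω| ^ k + |Z ω| ^ k)) ^ 2 ∂P) :=
          integral_mul_le_sqrt_mul_sqrt (Eventually.of_forall fun ω => abs_nonneg _)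
            (Eventually.of_forall fun ω => by positivity) hd (hg n)
      _ ≤ ‖y n - Z‖ * √((k + 1) ^ 2 * (4 * B k)) := by
          rw [hdn, Real.sqrt_sq (norm_nonneg _)]
          gcongr
          have h3 : ∫ ω, (k + 1 : ℝ) ^ 2 * (2 * (y n ω ^ (2 * k) + Z ω ^ (2 * k))) ∂P
              ≤ (k + 1) ^ 2 * (4 * B k) := by
            rw [integral_const_mul, integral_const_mul, integral_add (hint n k) (hZ k).1]
            refine mul_le_mul_of_nonneg_left ?_ (sq_nonneg _)
            linarith [hB n k, (hZ k).2]
          refine le_trans ?_ h3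
          refine integral_mono (hg n).integrable_sq
            ((((hint n k).add (hZ k).1).const_mul 2).const_mul _) fun ω => ?_
          simp only [mul_pow]
          gcongr
          have e : ∀ x : ℝ, x ^ (2 * k) = (|x| ^ k) ^ 2 := fun x => by
            rw [← pow_mul, mul_comm k 2, pow_mul, pow_mul, sq_abs]
          rw [e, e]
          nlinarith [sq_nonneg (|y n ω| ^ k - |Z ω| ^ k)]
  rw [tendsto_iff_dist_tendsto_zero]
  have hlim : Tendsto (fun n => ‖y n - Z‖ * √((k + 1) ^ 2 * (4 * B k))) atTop (𝓝 0) := by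
    have := (tendsto_iff_norm_sub_tendsto_zero.1 hy).mul_const (√((k + 1 : ℝ) ^ 2 * (4 * B k)))
    rwa [zero_mul] at this
  exact squeeze_zero (fun n => dist_nonneg) (fun n => by rw [Real.dist_eq]; exact hbound n) hlim

end L2

/-! ### Reduction of the algebraic chaos to polynomials -/

section Isonormal

open GaussianPolynomial

variable {H : Type*} [NormedAddCommGroup H] [InnerProductSpace ℝ H] {Ω : Type*}
  {mΩ : MeasurableSpace Ω} {P : Measure Ω} [IsProbabilityMeasure P] {X : H → Ω → ℝ}

/-- The moments of an element of the algebraic `q`-th chaos of an isonormal process are those of a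
polynomial in the `q`-th chaos of finitely many independent standard Gaussian variables. -/
lemma IsIsonormal.exists_mem_chaos_of_mem_span (hX : IsIsonormal X P) {q : ℕ} {z : Lp ℝ 2 P}
    (hq : q ≠ 0)
    (hz : z ∈ Submodule.span ℝ {F : Lp ℝ 2 P | ∃ h : H, (‖h‖ = 1 ∨ q = 0) ∧
      F =ᵐ[P] fun ω => Polynomial.aeval (X h ω) (Polynomial.hermite q)}) :
    ∃ (d : ℕ) (p : MvPolynomial (Fin d) ℝ), p ∈ chaos (Fin d) q ∧
      ∀ n : ℕ, Integrable (fun ω => z ω ^ n) P ∧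
        ∫ ω, z ω ^ n ∂P = gaussianExpectation (Fin d) (p ^ n) := by
  obtain ⟨n, a, g, rfl⟩ := Submodule.mem_span_set'.1 hz
  choose h hh hg using fun i => (g i).2
  -- In an orthonormal basis of the span of the finitely many `h i`, each `h i` has a coordinate
  -- vector of Euclidean norm one, as `chaos` requires.
  set S := Submodule.span ℝ (Set.range h)
  have : FiniteDimensional ℝ S := FiniteDimensional.span_of_finite ℝ (Set.finite_range h)
  set b := stdOrthonormalBasis ℝ S
  have hS : ∀ i, h i ∈ S := fun i => Submodule.subset_span ⟨i, rfl⟩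
  set c : Fin n → Fin (Module.finrank ℝ S) → ℝ := fun i j => b.repr ⟨h i, hS i⟩ j
  set e : Fin (Module.finrank ℝ S) → H := fun j => b j
  have he : Orthonormal ℝ e := b.orthonormal.comp_linearIsometry S.subtypeₗᵢ
  have hsum : ∀ i, h i = ∑ j, c i j • e j := fun i => by
    have := congrArg (S.subtype) (b.sum_repr ⟨h i, hS i⟩)
    rw [map_sum] at this
    simpa using this.symm
  have hc : ∀ i, ∑ j, c i j ^ 2 = 1 := fun i => by
    have h1 : ‖h i‖ = 1 := (hh i).resolve_right hq
    have h2 := b.repr.norm_map ⟨h i, hS i⟩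
    rw [EuclideanSpace.norm_eq] at h2
    simp only [Real.norm_eq_abs, sq_abs] at h2
    have h3 : ‖(⟨h i, hS i⟩ : S)‖ = 1 := h1
    rwa [h3, Real.sqrt_eq_one] at h2
  set p : MvPolynomial (Fin (Module.finrank ℝ S)) ℝ := ∑ i, a i • hermiteForm q (c i)
  have hp : p ∈ chaos (Fin (Module.finrank ℝ S)) q := Submodule.sum_mem _ fun i _ =>
    Submodule.smul_mem _ _ (Submodule.subset_span ⟨c i, hc i, rfl⟩)
  have hae : ((∑ i, a i • (g i : Lp ℝ 2 P) : Lp ℝ 2 P) : Ω → ℝ)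
      =ᵐ[P] fun ω => MvPolynomial.eval (fun j => X (e j) ω) p := by
    have h1 : ∀ᵐ ω ∂P, ∀ i, (a i • (g i : Lp ℝ 2 P)) ω = a i * (g i : Lp ℝ 2 P) ω :=
      ae_all_iff.2 fun i => Lp.coeFn_smul (a i) (g i : Lp ℝ 2 P)
    filter_upwards [Lp.coeFn_finsetSum Finset.univ fun i => a i • (g i : Lp ℝ 2 P), h1,
      ae_all_iff.2 hg, ae_all_iff.2 fun i => hX.ae_eq_sum (c i) e (hsum i)] with ω h0 h1 h2 h3
    rw [h0]
    simp only [Finset.sum_apply, h1, h2, h3, p, map_sum, MvPolynomial.smul_eval]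
    refine Finset.sum_congr rfl fun i _ => ?_
    rw [hermiteForm, ← eval_linearForm, Polynomial.aeval_def, Polynomial.aeval_def,
      Polynomial.hom_eval₂]
    congr 2
    exact RingHom.ext_int _ _
  have hlaw := hX.hasLaw_pi he
  refine ⟨_, p, hp, fun k => ?_⟩
  have hpow : (fun ω => (∑ i, a i • (g i : Lp ℝ 2 P) : Lp ℝ 2 P) ω ^ k)
      =ᵐ[P] (fun x => MvPolynomial.eval x (p ^ k)) ∘ fun ω j => X (e j) ω := by
    filter_upwards [hae] with ω hω
    rw [hω, Function.comp_apply, map_pow]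
  have hint := integrable_eval_pi (p ^ k)
  have hmeas := hint.aestronglyMeasurable
  constructor
  · rw [integrable_congr hpow]
    rw [← hlaw.map_eq] at hint hmeas
    exact (integrable_map_measure hmeas hlaw.aemeasurable).1 hint
  · rw [integral_congr_ae hpow, hlaw.integral_comp hmeas, gaussianExpectation_apply]

end Isonormal

/-! ### Normalization and passage to the limit -/

theorem proposition3p7
    {H : Type*} [NormedAddCommGroup H] [InnerProductSpace ℝ H] [CompleteSpace H]
    [TopologicalSpace.SeparableSpace H]
    {Ω : Type*} {mΩ : MeasurableSpace Ω} (P : Measure Ω) [IsProbabilityMeasure P]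
    (X : H → Ω → ℝ) (hX : IsIsonormal X P)
    {Ω' : Type*} {mΩ' : MeasurableSpace Ω'} (P' : Measure Ω')
    (N : Ω' → ℝ) (hN : HasLaw N (gaussianReal 0 1) P')
    (q : ℕ) (hq : 2 ≤ q)
    (Z : Lp ℝ 2 P) (hZ : Z ∈ wienerChaos X P q) (hVar : Var[Z; P] = 1)
    (k : ℕ) (hk : 3 ≤ k) :
    -- the moments of `Z` exist, and the quantity under the square root is nonnegative
    Integrable (fun ω => (Z ω) ^ k) P ∧ Integrable (fun ω => (Z ω) ^ 4) P ∧
      0 ≤ (∫ ω, (Z ω) ^ 4 ∂P) - ∫ ω, (N ω) ^ 4 ∂P' ∧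
      |(∫ ω, (Z ω) ^ k ∂P) - ∫ ω, (N ω) ^ k ∂P'| ≤
        momentConst k q * √((∫ ω, (Z ω) ^ 4 ∂P) - ∫ ω, (N ω) ^ 4 ∂P') := by
  open Filter Topology GaussianPolynomial in
  set S := Submodule.span ℝ {F : Lp ℝ 2 P | ∃ h : H, (‖h‖ = 1 ∨ q = 0) ∧
    F =ᵐ[P] fun ω => Polynomial.aeval (X h ω) (Polynomial.hermite q)}
  have hS := fun (z : Lp ℝ 2 P) (hz : z ∈ S) =>
    hX.exists_mem_chaos_of_mem_span (by omega : q ≠ 0) hz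
  set γ : ℕ → ℝ := fun n => ∫ x, x ^ n ∂gaussianReal 0 1 with hγdef
  have hγN : ∀ n, ∫ ω, (N ω) ^ n ∂P' = γ n := fun n =>
    hN.integral_comp (f := fun x : ℝ => x ^ n) (by fun_prop)
  have hγ0 : γ 0 = 1 := by simp [hγdef]
  have hγ1 : γ 1 = 0 := (integral_pow_succ_gaussianReal 0).trans (by simp)
  have hγ : ∀ n, γ (n + 2) = (n + 1) * γ n := fun n => by
    have := integral_pow_succ_gaussianReal (n + 1)
    push_cast at this
    exact this
  have hγ4 : γ 4 = 3 := by
    rw [hγ 2, hγ 0, hγ0]; norm_num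
  -- moment bounds and moment convergence for sequences in the algebraic chaos
  have hbound : ∀ z ∈ S, ∀ m : ℕ, ∫ ω, z ω ^ (2 * m) ∂P ≤
      (2 * m + 1) ^ (q * m) * (‖z‖ ^ 2) ^ m := by
    intro z hz m
    obtain ⟨d, p, hp, hm⟩ := hS z hz
    rw [← integral_sq_eq_norm_sq, (hm _).2, (hm _).2]
    rcases m with _ | m
    · simp [isGaussianExpectation_gaussianExpectation.map_one]
    · refine (isGaussianExpectation_gaussianExpectation.map_pow_two_mul_le hp m).trans ?_
      have h0 : 0 ≤ gaussianExpectation (Fin d) (p ^ 2) :=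
        isGaussianExpectation_gaussianExpectation.nonneg _ fun x => by
          rw [map_pow]; positivity
      gcongr
      linarith
  have hconv : ∀ y : ℕ → Lp ℝ 2 P, (∀ n, y n ∈ S) → Tendsto y atTop (𝓝 Z) → ∀ j : ℕ,
      Integrable (fun ω => Z ω ^ j) P ∧
        Tendsto (fun n => ∫ ω, y n ω ^ j ∂P) atTop (𝓝 (∫ ω, Z ω ^ j ∂P)) := by
    intro y hyS hy j
    obtain ⟨R, hR⟩ := hy.norm.bddAbove_range
    refine tendsto_integral_pow_of_tendsto hy
      (B := fun m => (2 * m + 1) ^ (q * m) * (R ^ 2) ^ m) (fun n m => ?_) (fun n m => ?_) j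
    · obtain ⟨d, p, hp, hm⟩ := hS _ (hyS n)
      exact (hm _).1
    · refine (hbound _ (hyS n) m).trans ?_
      have : ‖y n‖ ≤ R := hR ⟨n, rfl⟩
      gcongr
  obtain ⟨z, hzS, hz⟩ : ∃ z : ℕ → Lp ℝ 2 P, (∀ n, z n ∈ S) ∧ Tendsto z atTop (𝓝 Z) :=
    mem_closure_iff_seq_limit.1 hZ
  have hmean : ∫ ω, Z ω ∂P = 0 := by
    have h1 := (hconv z hzS hz 1).2
    simp only [pow_one] at h1
    refine tendsto_nhds_unique h1 ?_
    refine tendsto_const_nhds.congr fun n => ?_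
    obtain ⟨d, p, hp, hm⟩ := hS _ (hzS n)
    have := (hm 1).2
    simp only [pow_one] at this
    rw [this, isGaussianExpectation_gaussianExpectation.map_eq_zero_of_mem_chaos (by omega) hp]
  have hnorm : ‖Z‖ = 1 := by
    rw [variance_eq_sub (Lp.memLp Z), hmean] at hVar
    have h1 : ∫ ω, Z ω ^ 2 ∂P = 1 := by simpa using hVar
    rw [integral_sq_eq_norm_sq] at h1
    exact (pow_eq_one_iff_of_nonneg (norm_nonneg _) two_ne_zero).1 h1
  -- The polynomial estimates need unit second moment. Rescaling does not change the limit since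
  -- `‖Z‖ = 1`, but normalizes only where `z n ≠ 0`, that is, eventually.
  set y : ℕ → Lp ℝ 2 P := fun n => ‖z n‖⁻¹ • z n with hydef
  have hyS : ∀ n, y n ∈ S := fun n => Submodule.smul_mem _ _ (hzS n)
  have hy : Tendsto y atTop (𝓝 Z) := by
    have h1 := (hz.norm.inv₀ (by rw [hnorm]; exact one_ne_zero)).smul hz
    rwa [hnorm, inv_one, one_smul] at h1
  have hyn : ∀ᶠ n in atTop, ∫ ω, y n ω ^ 2 ∂P = 1 := by
    filter_upwards [hz.norm.eventually_ne (by rw [hnorm]; exact one_ne_zero : ‖Z‖ ≠ 0)] with n hn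
    rw [integral_sq_eq_norm_sq, hydef]
    simp only [norm_smul, norm_inv, norm_norm]
    rw [inv_mul_cancel₀ hn, one_pow]
  have hlim := hconv y hyS hy
  rw [hγN, hγN, hγ4]
  refine ⟨(hlim k).1, (hlim 4).1, ?_, ?_⟩
  · rw [sub_nonneg]
    refine ge_of_tendsto (hlim 4).2 ?_
    filter_upwards [hyn] with n hn
    obtain ⟨d, p, hp, hm⟩ := hS _ (hyS n)
    rw [(hm 2).2] at hn
    rw [(hm 4).2]
    exact isGaussianExpectation_gaussianExpectation.three_le_map_pow_four hq hp hn
  · refine le_of_tendsto_of_tendsto ((hlim k).2.sub_const (γ k)).abs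
      ((((hlim 4).2.sub_const 3).sqrt).const_mul (momentConst k q)) ?_
    filter_upwards [hyn] with n hn
    obtain ⟨d, p, hp, hm⟩ := hS _ (hyS n)
    rw [(hm 2).2] at hn
    rw [(hm 4).2, (hm k).2]
    exact isGaussianExpectation_gaussianExpectation.abs_map_pow_sub_le (by omega) hp hn hγ0 hγ1
      hγ hk
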